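/- Let $X=(X_t)_{t\ge 0}$ be a real-valued Lévy process with $X_0=0$ on a probability space $(\Omega,\mathcal F,P)$ such that $E[e^{2X_1}]<\infty$, $E[|X_1|^n]<\infty$ for $n=1,\dots,5$, and $\mathrm{Var}(X_1)>0$. Put $\mu=E[X_1]$, $\sigma=\sqrt{\mathrm{Var}(X_1)}$, $$\mathrm{Skew}=\frac{E[(X_1-\mu)^3]}{\sigma^3},\qquad \mathrm{ExKurt}=\frac{E[(X_1-\mu)^4]}{\sigma^4}-3 .$$ For $\lambda\in(0,1]$ let $X^\lambda_t=(1-\tfrac1\lambda)\mu t+\lambda X_{t/\lambda^2}$, and let $X^0_t=\mu t+\sigma W_t$ with a standard Brownian motion $W$ (possibly on another probability space). For $\lambda\in[0,1]$ let $\kappa^\lambda$ be the cumulant generating function of $X^\lambda$, i.e. the unique continuous function on $D^\lambda=\{z\in\mathbb C: E[e^{\mathrm{Re}(z)X^\lambda_1}]<\infty\}$ with $E[e^{zX^\lambda_t}]=e^{t\kappa^\lambda(z)}$ for all $t\ge0$, $z\in D^\lambda$. Put $\bar\kappa^\lambda(y,z)=\kappa^\lambda(y+z)-\kappa^\lambda(y)-\kappa^\lambda(z)$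 and let $q(\lambda)=\Lambda^\lambda=\kappa^\lambda(1)/\bar\kappa^\lambda(1,1)$ be the mean-variance ratio in the model with parameter $\lambda$; $\Lambda=\Lambda^1$ is the mean-variance ratio for $X$ itself. Then $q$ is twice continuously differentiable on $[0,1)$, and also on the closed interval $[0,1]$ if $2$ is an interior point of $D^1$. With one-sided derivatives at $0$, the terms $\Lambda^{(0)}=q(0)$, $\Lambda^{(1)}=q'(0)$, $\Lambda^{(2)}=q''(0)$ are $$\Lambda^{(0)}=\frac{\mu+\frac12\sigma^2}{\sigma^2},\qquad \Lambda^{(1)}=\mathrm{Skew}\,\sigma\left(\tfrac16-\Lambda^{(0)}\right),$$ $$\Lambda^{(2)}=\mathrm{Skew}^2\sigma^2\left(2\Lambda^{(0)}-\tfrac13\right)+\tfrac16\,\mathrm{ExKurt}\,\sigma^2\left(\tfrac12-7\Lambda^{(0)}\right),$$ so that the second-order approximation $q(0)+q'(0)+\tfrac12q''(0)$ to $\Lambda$ equals $\Lambda^{(0)}+\Lambda^{(1)}+\tfrac12\Lambda^{(2)}$. -/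

import Mathlib

open MeasureTheory ProbabilityTheory Filter Topology
open scoped NNReal

noncomputable section

/-- A real-valued Lévy process with time set `[0, ∞)`. -/
structure IsLevyProcess {Ω : Type*} [MeasurableSpace Ω] (X : ℝ≥0 → Ω → ℝ) (P : Measure Ω) :
    Prop where
  measurable : ∀ t, Measurable (X t)
  zero : ∀ᵐ ω ∂P, X 0 ω = 0
  indepIncrements : HasIndepIncrements X P
  stationaryIncrements : ∀ s t, IdentDistrib (fun ω ↦ X (s + t) ω - X s ω) (X t) P P
  continuousInProbability : ∀ t, TendstoInMeasure P X (𝓝 t) (X t)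
  cadlag : ∀ᵐ ω ∂P, ∀ t, ContinuousWithinAt (fun s ↦ X s ω) (Set.Ici t) t ∧
    ∃ l, Tendsto (fun s ↦ X s ω) (𝓝[<] t) (𝓝 l)

/-- The standing moment conditions on the Lévy process. -/
structure MomentConditions {Ω : Type*} [MeasurableSpace Ω] (X : ℝ≥0 → Ω → ℝ) (P : Measure Ω) :
    Prop where
  expMoment : Integrable (fun ω ↦ Real.exp (2 * X 1 ω)) P
  moments : ∀ n ∈ Finset.Icc 1 5, Integrable (fun ω ↦ |X 1 ω| ^ n) P
  variance_pos : 0 < variance (X 1) P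

/-- Skewness of a random variable. -/
def skewness {Ω : Type*} [MeasurableSpace Ω] (Y : Ω → ℝ) (P : Measure Ω) : ℝ :=
  (∫ ω, (Y ω - ∫ ω', Y ω' ∂P) ^ 3 ∂P) / √(variance Y P) ^ 3

/-- Excess kurtosis of a random variable. -/
def excessKurtosis {Ω : Type*} [MeasurableSpace Ω] (Y : Ω → ℝ) (P : Measure Ω) : ℝ :=
  (∫ ω, (Y ω - ∫ ω', Y ω' ∂P) ^ 4 ∂P) / √(variance Y P) ^ 4 - 3

/-- The drift rate `μ = E[X₁]`. -/
def driftRate {Ω : Type*} [MeasurableSpace Ω] (X : ℝ≥0 → Ω → ℝ) (P : Measure Ω) : ℝ :=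
  ∫ ω, X 1 ω ∂P

/-- The volatility `σ = √Var(X₁)`. -/
def volatility {Ω : Type*} [MeasurableSpace Ω] (X : ℝ≥0 → Ω → ℝ) (P : Measure Ω) : ℝ :=
  √(variance (X 1) P)

/-- The domain `D = {y ∈ ℂ : E[exp(Re(y) Y₁)] < ∞}`. -/
def expDomain {Ω : Type*} [MeasurableSpace Ω] (Y : ℝ≥0 → Ω → ℝ) (P : Measure Ω) : Set ℂ :=
  {y | Integrable (fun ω ↦ Real.exp (y.re * Y 1 ω)) P}

/-- `κ` is a cumulant generating function of the process `Y`: a continuous function on the domain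
`D` with `E[exp(z Y_t)] = exp(t κ(z))` for all `t ≥ 0`, `z ∈ D`. -/
structure IsCumulantGenFun {Ω : Type*} [MeasurableSpace Ω] (Y : ℝ≥0 → Ω → ℝ) (P : Measure Ω)
    (κ : ℂ → ℂ) : Prop where
  continuousOn : ContinuousOn κ (expDomain Y P)
  integral_eq : ∀ z ∈ expDomain Y P, ∀ t : ℝ≥0,
    ∫ ω, Complex.exp (z * (Y t ω : ℂ)) ∂P = Complex.exp ((t : ℂ) * κ z)

open Classical in
/-- The cumulant generating function of the process `Y`: for `z ∈ D`, `κ(z)` is the number `w`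
with `E[exp(z Y_t)] = exp(t w)` for all real `t ≥ 0`. Since all real times occur, `w` is determined
pointwise by this equation, see `cumulantGenFun_eq`; the value is `0` where there is no such `w`. -/
def cumulantGenFun {Ω : Type*} [MeasurableSpace Ω] (Y : ℝ≥0 → Ω → ℝ) (P : Measure Ω)
    (z : ℂ) : ℂ :=
  if h : z ∈ expDomain Y P ∧ ∃ w : ℂ, ∀ t : ℝ≥0,
      ∫ ω, Complex.exp (z * (Y t ω : ℂ)) ∂P = Complex.exp ((t : ℂ) * w)
  then h.2.choose else 0

/-- An exponent is determined by its exponentials at all times `t ≥ 0`. -/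
theorem eq_of_exp_mul_eq {v w : ℂ}
    (h : ∀ t : ℝ≥0, Complex.exp ((t : ℂ) * v) = Complex.exp ((t : ℂ) * w)) : v = w := by
  have hd : ∀ u : ℂ, HasDerivWithinAt (fun t : ℝ ↦ Complex.exp ((t : ℂ) * u)) u
      (Set.Ici 0) 0 := by
    intro u
    have h1 : HasDerivAt (fun t : ℝ ↦ (t : ℂ) * u) u 0 := by
      simpa using (Complex.ofRealCLM.hasDerivAt (x := (0 : ℝ))).mul_const u
    simpa using h1.cexp.hasDerivWithinAt
  have hv : HasDerivWithinAt (fun t : ℝ ↦ Complex.exp ((t : ℂ) * v)) w (Set.Ici 0) 0 := by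
    refine (hd w).congr (fun t ht ↦ ?_) ?_
    · exact h ⟨t, ht⟩
    · simp
  exact (uniqueDiffOn_Ici (0 : ℝ) 0 Set.self_mem_Ici).eq_deriv _ (hd v) hv

/-- The cumulant generating function agrees with every function that has its defining
properties. -/
theorem cumulantGenFun_eq {Ω : Type*} [MeasurableSpace Ω] {Y : ℝ≥0 → Ω → ℝ} {P : Measure Ω}
    {κ : ℂ → ℂ} (hκ : IsCumulantGenFun Y P κ) {z : ℂ} (hz : z ∈ expDomain Y P) :
    cumulantGenFun Y P z = κ z := by
  have h : z ∈ expDomain Y P ∧ ∃ w : ℂ, ∀ t : ℝ≥0,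
      ∫ ω, Complex.exp (z * (Y t ω : ℂ)) ∂P = Complex.exp ((t : ℂ) * w) :=
    ⟨hz, κ z, hκ.integral_eq z hz⟩
  rw [cumulantGenFun, dif_pos h]
  refine eq_of_exp_mul_eq fun t ↦ ?_
  rw [← h.2.choose_spec t, hκ.integral_eq z hz t]

/-- The process `X^λ_t = (1 - 1/λ) μ t + λ X_{t/λ²}` for `λ > 0`. -/
def levyCurve {Ω : Type*} [MeasurableSpace Ω] (X : ℝ≥0 → Ω → ℝ) (P : Measure Ω) (l : ℝ) :
    ℝ≥0 → Ω → ℝ :=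
  fun t ω ↦ (1 - 1 / l) * driftRate X P * t + l * X (t / (Real.toNNReal l) ^ 2) ω

/-- The limiting process `X^0_t = μ t + σ W_t`. -/
def brownianLimit {Ω Ω' : Type*} [MeasurableSpace Ω] (X : ℝ≥0 → Ω → ℝ)
    (P : Measure Ω) (W : ℝ≥0 → Ω' → ℝ) : ℝ≥0 → Ω' → ℝ :=
  fun t ω ↦ driftRate X P * t + volatility X P * W t ω

/-- The cumulant generating function `κ^λ` of `X^λ`; the Brownian motion `W` driving `X^0` may
live on a probability space of its own. -/
def curveCumulant {Ω Ω' : Type*} [MeasurableSpace Ω] [MeasurableSpace Ω'] (X : ℝ≥0 → Ω → ℝ)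
    (P : Measure Ω) (W : ℝ≥0 → Ω' → ℝ) (P' : Measure Ω') (l : ℝ) : ℂ → ℂ :=
  if l = 0 then cumulantGenFun (brownianLimit X P W) P'
  else cumulantGenFun (levyCurve X P l) P

/-- `κ̄(y, z) = κ(y + z) - κ(y) - κ(z)`. -/
def kappaBar (κ : ℂ → ℂ) (y z : ℂ) : ℂ := κ (y + z) - κ y - κ z

/-- The mean-variance ratio `Λ^λ = κ^λ(1) / κ̄^λ(1, 1)` in the model with parameter `λ`. -/
def meanVarianceRatio {Ω Ω' : Type*} [MeasurableSpace Ω] [MeasurableSpace Ω'] (X : ℝ≥0 → Ω → ℝ)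
    (P : Measure Ω) (W : ℝ≥0 → Ω' → ℝ) (P' : Measure Ω') (l : ℝ) : ℂ :=
  curveCumulant X P W P' l 1 / kappaBar (curveCumulant X P W P' l) 1 1

/-- The `n`-th (one-sided) derivative at `0` of a function `q` on `[0, 1]`. -/
def approxTerm (q : ℝ → ℂ) (n : ℕ) : ℂ := iteratedDerivWithin n q (Set.Icc 0 1) 0

/-- The second-order approximation `q(0) + q'(0) + q''(0)/2` to `q(1)`. -/
def secondOrderApprox (q : ℝ → ℂ) : ℂ :=
  approxTerm q 0 + approxTerm q 1 + 1 / 2 * approxTerm q 2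

end

/-! Only real arguments matter. Let `F x = (κ x - μ x) / x ^ 2` with `F 0 = σ ^ 2 / 2`. Scaling
gives `κ^λ u = u μ + u ^ 2 F (u λ)`, also at `λ = 0` (`curveCumulant_ofReal`), so `q λ = (μ + F λ) /
(4 F (2 λ) - 2 F λ)`. This rests on the linearity in `t` of the log of the moment generating
function of `X t` (`IsLevyProcess.mgf_eq_exp`).

The denominator is positive because `exp (λ X 1)` has positive variance for `λ > 0`, and it equals
`σ ^ 2` at `0`. It remains to show that `F` is twice continuously differentiable up to `0`. As `0`
may be a boundary point of the exponential domain, analyticity is not available there. Instead the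
first four derivatives of the centred cumulant function have right limits at `0`, by dominated
convergence and the polynomial moments, and L'Hôpital turns these into Taylor remainders. The third
and fourth cumulants give `F' 0` and `F'' 0`, and the quotient rule gives the coefficients. -/

/-! ### Additive functions on the half-line -/

/-- Subtracting `t * h 1` leaves an additive `g` vanishing at `1`, hence periodic with some period
`1 / (N + 1) < δ`. The bound near zero thus becomes global, and scaling by `n` improves it to `0 ≤
g`. -/
theorem additive_eq_mul_of_bddBelow_near_zero {h : ℝ≥0 → ℝ}
    (hadd : ∀ s t, h (s + t) = h s + h t) {δ : ℝ≥0} (hδ : 0 < δ) {C : ℝ}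
    (hC : ∀ t ≤ δ, C ≤ h t) (t : ℝ≥0) : h t = t * h 1 := by
  set g : ℝ≥0 → ℝ := fun t ↦ h t - t * h 1 with hg
  have gadd : ∀ s t, g (s + t) = g s + g t := fun s t ↦ by
    simp only [hg, hadd]; push_cast; ring
  have g1 : g 1 = 0 := by simp [hg]
  have g0 : g 0 = 0 := by have := gadd 0 0; simp only [add_zero] at this; linarith
  have gnat : ∀ (n : ℕ) t, g (n * t) = n * g t := by
    intro n t
    induction n with
    | zero => simp [g0]
    | succ n ih => push_cast; rw [add_mul, one_mul, gadd, ih]; ring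
  obtain ⟨N, hN⟩ := exists_nat_one_div_lt hδ
  have hN0 : ((N : ℝ≥0) + 1) ≠ 0 := by positivity
  have gN : g (1 / ((N : ℝ≥0) + 1)) = 0 := by
    have h1 := gnat (N + 1) (1 / ((N : ℝ≥0) + 1))
    rw [Nat.cast_succ, mul_one_div_cancel hN0, g1] at h1
    have : ((N + 1 : ℕ) : ℝ) ≠ 0 := by positivity
    exact (mul_eq_zero.1 h1.symm).resolve_left this
  have gbd : ∀ s, C - |h 1| * δ ≤ g s := by
    intro s
    set k : ℕ := ⌊s * (N + 1)⌋₊ with hk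
    have hk1 : (k : ℝ≥0) ≤ s * (N + 1) := Nat.floor_le (by positivity)
    have hk2 : s * (N + 1) < k + 1 := Nat.lt_floor_add_one _
    have hle : (k : ℝ≥0) * (1 / (N + 1)) ≤ s := by
      rw [mul_one_div, div_le_iff₀ (by positivity)]; exact hk1
    obtain ⟨r, hr⟩ := exists_add_of_le hle
    have hrδ : r ≤ δ := by
      refine le_trans ?_ hN.le
      have : s ≤ (k : ℝ≥0) * (1 / (N + 1)) + 1 / (N + 1) := by
        rw [mul_one_div, ← add_div, le_div_iff₀ (by positivity)]; exact hk2.le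
      rw [hr] at this
      exact le_of_add_le_add_left this
    rw [hr, gadd, gnat, gN, mul_zero, zero_add]
    have h3 := hC r hrδ
    have h4 : (r : ℝ) * h 1 ≤ |h 1| * δ := by
      calc (r : ℝ) * h 1 ≤ r * |h 1| := by gcongr; exact le_abs_self _
        _ ≤ δ * |h 1| := by gcongr
        _ = _ := mul_comm _ _
    simp only [hg]; linarith
  have gnonneg : ∀ s, 0 ≤ g s := by
    intro s
    by_contra! hs
    obtain ⟨n, hn⟩ := exists_nat_gt ((C - |h 1| * δ) / g s)
    have h1 := gbd (n * s)
    rw [gnat] at h1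
    rw [div_lt_iff_of_neg hs] at hn
    linarith
  -- Two nonnegative values `g t` and `g r` add up to `g n = 0`.
  obtain ⟨n, hn⟩ := exists_nat_ge t
  obtain ⟨r, hr⟩ := exists_add_of_le hn
  have h1 : g n = 0 := by simpa [g1] using gnat n 1
  rw [hr, gadd] at h1
  have h2 : g t = 0 := by linarith [gnonneg t, gnonneg r]
  simp only [hg] at h2; linarith

/-! ### Exponential moments of a Lévy process -/

namespace IsLevyProcess

variable {Ω : Type*} [MeasurableSpace Ω] {P : Measure Ω} {X : ℝ≥0 → Ω → ℝ}

/-- Stated in `ENNReal`, so that it needs no integrability and can be used to transfer integrability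
between times. -/
theorem lintegral_exp_add (hX : IsLevyProcess X P) (u : ℝ) (s t : ℝ≥0) :
    ∫⁻ ω, ENNReal.ofReal (Real.exp (u * X (s + t) ω)) ∂P =
      (∫⁻ ω, ENNReal.ofReal (Real.exp (u * X s ω)) ∂P) *
        ∫⁻ ω, ENNReal.ofReal (Real.exp (u * X t ω)) ∂P := by
  have hf : Measurable fun x : ℝ ↦ ENNReal.ofReal (Real.exp (u * x)) := by fun_prop
  have hind : (X s) ⟂ᵢ[P] (X (s + t) - X s) :=
    hX.indepIncrements.indepFun_eval_sub zero_le le_self_add hX.zero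
  have h1 := lintegral_mul_eq_lintegral_mul_lintegral_of_indepFun
    (hf.comp (hX.measurable s)) (hf.comp ((hX.measurable (s + t)).sub (hX.measurable s)))
    (hind.comp hf hf)
  have h2 : ∫⁻ ω, ENNReal.ofReal (Real.exp (u * (X (s + t) ω - X s ω))) ∂P =
      ∫⁻ ω, ENNReal.ofReal (Real.exp (u * X t ω)) ∂P :=
    ((hX.stationaryIncrements s t).comp hf).lintegral_eq
  rw [← h2]
  refine Eq.trans ?_ h1
  refine lintegral_congr fun ω ↦ ?_
  simp only [Pi.mul_apply, Function.comp_apply, Pi.sub_apply]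
  rw [← ENNReal.ofReal_mul (Real.exp_pos _).le, ← Real.exp_add]
  congr 2; ring

theorem integrable_exp_iff (hX : IsLevyProcess X P) (u : ℝ) (t : ℝ≥0) :
    Integrable (fun ω ↦ Real.exp (u * X t ω)) P ↔
      ∫⁻ ω, ENNReal.ofReal (Real.exp (u * X t ω)) ∂P ≠ ⊤ := by
  have hm : Measurable fun ω ↦ Real.exp (u * X t ω) := by
    have := hX.measurable t; fun_prop
  exact (lintegral_ofReal_ne_top_iff_integrable hm.aestronglyMeasurable
    (ae_of_all _ fun ω ↦ (Real.exp_pos _).le)).symm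

theorem mgf_add (hX : IsLevyProcess X P) (u : ℝ) (s t : ℝ≥0) :
    mgf (X (s + t)) P u = mgf (X s) P u * mgf (X t) P u := by
  have key : ∀ r, mgf (X r) P u =
      (∫⁻ ω, ENNReal.ofReal (Real.exp (u * X r ω)) ∂P).toReal := by
    intro r
    have hm : Measurable fun ω ↦ Real.exp (u * X r ω) := by
      have := hX.measurable r; fun_prop
    exact integral_eq_lintegral_of_nonneg_ae (ae_of_all _ fun ω ↦ (Real.exp_pos _).le)
      hm.aestronglyMeasurable
  rw [key, key, key, hX.lintegral_exp_add, ENNReal.toReal_mul]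

variable [IsProbabilityMeasure P]

theorem lintegral_exp_ne_zero (hX : IsLevyProcess X P) (u : ℝ) (t : ℝ≥0) :
    ∫⁻ ω, ENNReal.ofReal (Real.exp (u * X t ω)) ∂P ≠ 0 := by
  have hm : Measurable fun ω ↦ ENNReal.ofReal (Real.exp (u * X t ω)) := by
    have := hX.measurable t; fun_prop
  rw [Ne, lintegral_eq_zero_iff hm]
  intro h
  have : ∀ᵐ ω ∂P, False := by
    filter_upwards [h] with ω hω
    exact absurd hω (by simp [Real.exp_pos])
  simp [IsProbabilityMeasure.ne_zero] at this

/-- For `s ≤ 1` the value at time `1` is a product with a nonzero cofactor, so an infinite factor at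
`s` is impossible. Larger times are finite products of such factors. -/
theorem integrable_exp (hX : IsLevyProcess X P) {u : ℝ}
    (hu : Integrable (fun ω ↦ Real.exp (u * X 1 ω)) P) (t : ℝ≥0) :
    Integrable (fun ω ↦ Real.exp (u * X t ω)) P := by
  have hle : ∀ s ≤ (1 : ℝ≥0), Integrable (fun ω ↦ Real.exp (u * X s ω)) P := by
    intro s hs
    obtain ⟨r, hr⟩ := exists_add_of_le hs
    rw [hX.integrable_exp_iff, hr, hX.lintegral_exp_add] at hu
    rw [hX.integrable_exp_iff]
    intro htop
    exact hu (by rw [htop, ENNReal.top_mul (hX.lintegral_exp_ne_zero u r)])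
  have hadd : ∀ s r, Integrable (fun ω ↦ Real.exp (u * X s ω)) P →
      Integrable (fun ω ↦ Real.exp (u * X r ω)) P →
      Integrable (fun ω ↦ Real.exp (u * X (s + r) ω)) P := by
    intro s r hs hr
    rw [hX.integrable_exp_iff] at *
    rw [hX.lintegral_exp_add]
    exact ENNReal.mul_ne_top hs hr
  have hnat : ∀ n : ℕ, Integrable (fun ω ↦ Real.exp (u * X n ω)) P := by
    intro n
    induction n with
    | zero => simpa using hle 0 zero_le_one
    | succ n ih => simpa using hadd n 1 ih hu
  obtain ⟨r, hr⟩ := exists_add_of_le (Nat.floor_le (zero_le (a := t)))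
  have hr1 : r ≤ 1 := by
    have h1 := (Nat.lt_floor_add_one t).le
    have h2 : (⌊t⌋₊ : ℝ≥0) + r ≤ ⌊t⌋₊ + 1 := by rw [← hr]; exact h1
    exact le_of_add_le_add_left h2
  rw [hr]
  exact hadd _ _ (hnat _) (hle r hr1)

/-- Continuity in probability at `0` gives `|X t| < 1` with probability at least `1 / 2` for small
`t`, and there the exponential is at least `exp (-|u|)`. -/
theorem exists_mgf_lower_bound (hX : IsLevyProcess X P) {u : ℝ}
    (hu : Integrable (fun ω ↦ Real.exp (u * X 1 ω)) P) :
    ∃ δ : ℝ≥0, 0 < δ ∧ ∀ t ≤ δ, Real.exp (-|u|) / 2 ≤ mgf (X t) P u := by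
  have h0 := hX.continuousInProbability 0 1 one_pos
  have h1 : ∀ᶠ t in 𝓝 (0 : ℝ≥0), P {ω | 1 ≤ edist (X t ω) (X 0 ω)} < ENNReal.ofReal (1 / 2) :=
    h0.eventually (gt_mem_nhds (by simp))
  obtain ⟨δ, hδ, hball⟩ := Metric.eventually_nhds_iff.1 h1
  refine ⟨(δ / 2).toNNReal, Real.toNNReal_pos.2 (half_pos hδ), fun t ht ↦ ?_⟩
  have ht2 : (t : ℝ) < δ := by
    have : (t : ℝ) ≤ δ / 2 := by
      simpa [Real.coe_toNNReal _ (half_pos hδ).le] using NNReal.coe_le_coe.2 ht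
    linarith
  have hPt := @hball t (by simpa [NNReal.dist_eq] using ht2)
  set A : Set Ω := {ω | 1 ≤ edist (X t ω) (X 0 ω)} with hA
  have hAm : MeasurableSet A :=
    measurableSet_le measurable_const ((hX.measurable t).edist (hX.measurable 0))
  have hAr : P.real A ≤ 1 / 2 := ENNReal.toReal_le_of_le_ofReal (by norm_num) hPt.le
  have hAc : 1 / 2 ≤ P.real Aᶜ := by rw [probReal_compl_eq_one_sub hAm]; linarith
  have hle : Aᶜ.indicator (fun _ ↦ Real.exp (-|u|)) ≤ᵐ[P] fun ω ↦ Real.exp (u * X t ω) := by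
    filter_upwards [hX.zero] with ω hω
    by_cases hωA : ω ∈ A
    · simp [hωA, (Real.exp_pos _).le]
    · rw [Set.indicator_of_mem (by simpa using hωA)]
      have h2 : |X t ω| < 1 := by
        have h3 : edist (X t ω) (X 0 ω) < 1 := by simpa [hA] using hωA
        rw [hω, edist_dist, Real.dist_eq, sub_zero, ENNReal.ofReal_lt_one] at h3
        exact h3
      refine Real.exp_le_exp.2 ?_
      have h4 : |u * X t ω| ≤ |u| := by
        rw [abs_mul]; exact mul_le_of_le_one_right (abs_nonneg _) h2.le
      exact (abs_le.1 h4).1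
  have h5 := integral_mono_ae ((integrable_const _).indicator hAm.compl)
    (hX.integrable_exp hu t) hle
  rw [integral_indicator_const _ hAm.compl, smul_eq_mul] at h5
  refine le_trans ?_ h5
  rw [div_eq_mul_one_div, mul_comm]
  gcongr

theorem mgf_eq_exp (hX : IsLevyProcess X P) {u : ℝ}
    (hu : Integrable (fun ω ↦ Real.exp (u * X 1 ω)) P) (t : ℝ≥0) :
    mgf (X t) P u = Real.exp (t * cgf (X 1) P u) := by
  have hpos : ∀ s, 0 < mgf (X s) P u := fun s ↦ mgf_pos (hX.integrable_exp hu s)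
  obtain ⟨δ, hδ, hb⟩ := hX.exists_mgf_lower_bound hu
  have h := additive_eq_mul_of_bddBelow_near_zero (h := fun s ↦ cgf (X s) P u)
    (fun s r ↦ by
      simp only [cgf]
      rw [hX.mgf_add, Real.log_mul (hpos s).ne' (hpos r).ne']) hδ
    (fun s hs ↦ Real.log_le_log (by positivity) (hb s hs)) t
  rw [← h, cgf, Real.exp_log (hpos t)]

end IsLevyProcess

/-! ### One-sided Taylor expansion at the endpoint -/

/-- One L'Hôpital step; iterating it integrates the limit of a top derivative up to a Taylor
remainder. -/
theorem HasDerivAt.tendsto_div_pow_succ {f f' : ℝ → ℝ} {b L : ℝ} (hb : 0 < b) (n : ℕ)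
    (hf : ∀ x ∈ Set.Ioo 0 b, HasDerivAt f (f' x) x) (h0 : Tendsto f (𝓝[>] 0) (𝓝 0))
    (hL : Tendsto (fun x ↦ f' x / x ^ n) (𝓝[>] 0) (𝓝 L)) :
    Tendsto (fun x ↦ f x / x ^ (n + 1)) (𝓝[>] 0) (𝓝 (L / (n + 1))) := by
  refine HasDerivAt.lhopital_zero_right_on_Ioo (f' := f')
    (g' := fun x ↦ ((n + 1 : ℕ) : ℝ) * x ^ n) hb hf
    (fun x _ ↦ by simpa using hasDerivAt_pow (n + 1) x)
    (fun x hx ↦ mul_ne_zero (by positivity) (pow_ne_zero _ hx.1.ne')) h0 ?_ ?_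
  · have : Tendsto (fun x : ℝ ↦ x ^ (n + 1)) (𝓝 0) (𝓝 (0 ^ (n + 1))) :=
      (continuous_pow (n + 1)).tendsto 0
    rw [zero_pow (by simp)] at this
    exact this.mono_left nhdsWithin_le_nhds
  · refine (hL.div_const ((n : ℝ) + 1)).congr fun x ↦ ?_
    push_cast
    rw [div_div, mul_comm]

theorem hasDerivWithinAt_Ico_of_tendsto {f f' : ℝ → ℝ} {b : ℝ}
    (hf : ∀ x ∈ Set.Ioo 0 b, HasDerivAt f (f' x) x)
    (h0 : Tendsto f (𝓝[>] 0) (𝓝 (f 0))) (h1 : Tendsto f' (𝓝[>] 0) (𝓝 (f' 0))) :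
    ∀ x ∈ Set.Ico 0 b, HasDerivWithinAt f (f' x) (Set.Ico 0 b) x := by
  intro x hx
  rcases hx.1.eq_or_lt with rfl | hx0
  · have hI : Set.Ioo 0 b ∈ 𝓝[>] (0 : ℝ) := Ioo_mem_nhdsGT hx.2
    refine (hasDerivWithinAt_Ici_of_tendsto_deriv (s := Set.Ioo 0 b)
      (fun y hy ↦ (hf y hy).differentiableAt.differentiableWithinAt)
      (h0.mono_left (nhdsWithin_mono _ Set.Ioo_subset_Ioi_self)) hI ?_).mono
        Set.Ico_subset_Ici_self
    refine h1.congr' ?_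
    filter_upwards [hI] with y hy using (hf y hy).deriv.symm
  · exact (hf x ⟨hx0, hx.2⟩).hasDerivWithinAt

theorem continuousOn_Ico_of_tendsto {f : ℝ → ℝ} {b : ℝ} (hf : ContinuousOn f (Set.Ioo 0 b))
    (h0 : Tendsto f (𝓝[>] 0) (𝓝 (f 0))) : ContinuousOn f (Set.Ico 0 b) := by
  intro x hx
  rcases hx.1.eq_or_lt with rfl | hx0
  · have : ContinuousWithinAt f (Set.Ici 0) 0 := by
      rw [← continuousWithinAt_Ioi_iff_Ici]; exact h0
    exact this.mono Set.Ico_subset_Ici_self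
  · exact (hf.continuousAt (Ioo_mem_nhds hx0 hx.2)).continuousWithinAt

/-- The function `m(x) / x²`, extended to `0` by the value `c`. -/
noncomputable def quadQuotient (m : ℝ → ℝ) (c : ℝ) (x : ℝ) : ℝ :=
  if x = 0 then c else m x / x ^ 2

/-- If `m` has four derivatives on `(0, b)` with right limits `0, 0, c₂, c₃, c₄` at `0`, then
`m(x) / x²` has two derivatives on `[0, b)`. -/
theorem exists_derivs_quadQuotient {m m₁ m₂ m₃ m₄ : ℝ → ℝ} {b c₂ c₃ c₄ : ℝ} (hb : 0 < b)
    (h₀ : ∀ x ∈ Set.Ioo 0 b, HasDerivAt m (m₁ x) x)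
    (h₁ : ∀ x ∈ Set.Ioo 0 b, HasDerivAt m₁ (m₂ x) x)
    (h₂ : ∀ x ∈ Set.Ioo 0 b, HasDerivAt m₂ (m₃ x) x)
    (h₃ : ∀ x ∈ Set.Ioo 0 b, HasDerivAt m₃ (m₄ x) x)
    (l₀ : Tendsto m (𝓝[>] 0) (𝓝 0)) (l₁ : Tendsto m₁ (𝓝[>] 0) (𝓝 0))
    (l₂ : Tendsto m₂ (𝓝[>] 0) (𝓝 c₂)) (l₃ : Tendsto m₃ (𝓝[>] 0) (𝓝 c₃))
    (l₄ : Tendsto m₄ (𝓝[>] 0) (𝓝 c₄)) :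
    ∃ f₁ f₂ : ℝ → ℝ, f₁ 0 = c₃ / 6 ∧ f₂ 0 = c₄ / 12 ∧ ContinuousOn f₂ (Set.Ico 0 b) ∧
      (∀ x ∈ Set.Ico 0 b, HasDerivWithinAt (quadQuotient m (c₂ / 2)) (f₁ x) (Set.Ico 0 b) x) ∧
      (∀ x ∈ Set.Ico 0 b, HasDerivWithinAt f₁ (f₂ x) (Set.Ico 0 b) x) := by
  have hId : Tendsto (fun x : ℝ ↦ x) (𝓝[>] 0) (𝓝 0) := tendsto_id.mono_left nhdsWithin_le_nhds
  -- remainders of the Taylor expansion at `0`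
  have t₃ : Tendsto (fun x ↦ (m₃ x - c₃) / x) (𝓝[>] 0) (𝓝 c₄) := by
    have := HasDerivAt.tendsto_div_pow_succ hb 0 (f := fun x ↦ m₃ x - c₃) (f' := m₄) (L := c₄)
      (fun x hx ↦ (h₃ x hx).sub_const _) (by simpa using l₃.sub_const c₃) (by simpa using l₄)
    simpa using this
  have t₂ : Tendsto (fun x ↦ (m₂ x - c₂ - c₃ * x) / x ^ 2) (𝓝[>] 0) (𝓝 (c₄ / 2)) := by
    have := HasDerivAt.tendsto_div_pow_succ hb 1 (f := fun x ↦ m₂ x - c₂ - c₃ * x)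
      (f' := fun x ↦ m₃ x - c₃) (L := c₄)
      (fun x hx ↦ by
        convert! ((h₂ x hx).sub_const c₂).sub ((hasDerivAt_id x).const_mul c₃) using 1
        simp)
      (by simpa using (l₂.sub_const c₂).sub (hId.const_mul c₃)) (by simpa using t₃)
    norm_num at this ⊢; exact this
  have t₁ : Tendsto (fun x ↦ (m₁ x - c₂ * x - c₃ / 2 * x ^ 2) / x ^ 3) (𝓝[>] 0)
      (𝓝 (c₄ / 6)) := by
    have := HasDerivAt.tendsto_div_pow_succ hb 2
      (f := fun x ↦ m₁ x - c₂ * x - c₃ / 2 * x ^ 2)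
      (f' := fun x ↦ m₂ x - c₂ - c₃ * x) (L := c₄ / 2)
      (fun x hx ↦ by
        convert! ((h₁ x hx).sub ((hasDerivAt_id x).const_mul c₂)).sub
          ((hasDerivAt_pow 2 x).const_mul (c₃ / 2)) using 1
        simp; ring)
      (by simpa using (l₁.sub (hId.const_mul c₂)).sub ((hId.pow 2).const_mul (c₃ / 2))) t₂
    norm_num [div_div] at this ⊢; exact this
  have t₀ : Tendsto (fun x ↦ (m x - c₂ / 2 * x ^ 2 - c₃ / 6 * x ^ 3) / x ^ 4) (𝓝[>] 0)
      (𝓝 (c₄ / 24)) := by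
    have := HasDerivAt.tendsto_div_pow_succ hb 3
      (f := fun x ↦ m x - c₂ / 2 * x ^ 2 - c₃ / 6 * x ^ 3)
      (f' := fun x ↦ m₁ x - c₂ * x - c₃ / 2 * x ^ 2) (L := c₄ / 6)
      (fun x hx ↦ by
        convert! ((h₀ x hx).sub ((hasDerivAt_pow 2 x).const_mul (c₂ / 2))).sub
          ((hasDerivAt_pow 3 x).const_mul (c₃ / 6)) using 1
        simp; ring)
      (by simpa using (l₀.sub ((hId.pow 2).const_mul (c₂ / 2))).sub
            ((hId.pow 3).const_mul (c₃ / 6))) t₁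
    norm_num [div_div] at this ⊢; exact this
  -- Off `0` these are the quotient rule; at `0` they are read off from `c₂ / 2 + c₃ / 6 * x + c₄ /
  -- 24 * x ^ 2`.
  set f₁ : ℝ → ℝ := fun x ↦ if x = 0 then c₃ / 6 else (x * m₁ x - 2 * m x) / x ^ 3 with hf₁
  set f₂ : ℝ → ℝ := fun x ↦ if x = 0 then c₄ / 12 else
    (x ^ 2 * m₂ x - 4 * x * m₁ x + 6 * m x) / x ^ 4 with hf₂
  have hnz : ∀ x ∈ Set.Ioo 0 b, ∀ᶠ y in 𝓝 x, y ≠ 0 := fun x hx ↦ eventually_ne_nhds hx.1.ne'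
  have d₀ : ∀ x ∈ Set.Ioo 0 b, HasDerivAt (quadQuotient m (c₂ / 2)) (f₁ x) x := by
    intro x hx
    have hx0 : x ≠ 0 := hx.1.ne'
    have h : HasDerivAt (fun y ↦ m y / y ^ 2) (f₁ x) x := by
      convert! (h₀ x hx).div (hasDerivAt_pow 2 x) (pow_ne_zero 2 hx0) using 1
      simp only [hf₁, if_neg hx0]; field_simp; push_cast; ring
    refine h.congr_of_eventuallyEq ?_
    filter_upwards [hnz x hx] with y hy using by simp [quadQuotient, hy]
  have d₁ : ∀ x ∈ Set.Ioo 0 b, HasDerivAt f₁ (f₂ x) x := by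
    intro x hx
    have hx0 : x ≠ 0 := hx.1.ne'
    have h : HasDerivAt (fun y ↦ (y * m₁ y - 2 * m y) / y ^ 3) (f₂ x) x := by
      convert! (((hasDerivAt_id x).mul (h₁ x hx)).sub ((h₀ x hx).const_mul 2)).div
        (hasDerivAt_pow 3 x) (pow_ne_zero 3 hx0) using 1
      simp only [hf₂, if_neg hx0, id, Pi.sub_apply, Pi.mul_apply]; field_simp; push_cast; ring
    refine h.congr_of_eventuallyEq ?_
    filter_upwards [hnz x hx] with y hy using by simp [hf₁, hy]
  have e₀ : Tendsto (quadQuotient m (c₂ / 2)) (𝓝[>] 0) (𝓝 (quadQuotient m (c₂ / 2) 0)) := by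
    have := (((t₀.mul (hId.pow 2))).add (hId.const_mul (c₃ / 6))).const_add (c₂ / 2)
    simp only [ne_eq, OfNat.ofNat_ne_zero, not_false_eq_true, zero_pow, mul_zero, add_zero] at this
    simp only [quadQuotient, if_true]
    refine this.congr' ?_
    filter_upwards [self_mem_nhdsWithin] with x hx
    have hx0 : x ≠ 0 := ne_of_gt hx
    rw [quadQuotient, if_neg hx0]; field_simp; ring
  have e₁ : Tendsto f₁ (𝓝[>] 0) (𝓝 (f₁ 0)) := by
    have := ((t₁.mul hId).sub ((t₀.mul hId).const_mul 2)).const_add (c₃ / 6)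
    simp only [mul_zero, sub_zero, add_zero] at this
    simp only [hf₁, if_true]
    refine this.congr' ?_
    filter_upwards [self_mem_nhdsWithin] with x hx
    have hx0 : x ≠ 0 := ne_of_gt hx
    rw [if_neg hx0]; field_simp; ring
  have e₂ : Tendsto f₂ (𝓝[>] 0) (𝓝 (f₂ 0)) := by
    -- The `c₂` and `c₃` terms cancel in the numerator of `f₂`, leaving only the three remainders.
    have := (t₂.sub (t₁.const_mul 4)).add (t₀.const_mul 6)
    simp only [hf₂, if_true]
    rw [show c₄ / 12 = c₄ / 2 - 4 * (c₄ / 6) + 6 * (c₄ / 24) by ring]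
    refine this.congr' ?_
    filter_upwards [self_mem_nhdsWithin] with x hx
    have hx0 : x ≠ 0 := ne_of_gt hx
    rw [if_neg hx0]; field_simp; ring
  refine ⟨f₁, f₂, by simp [hf₁], by simp [hf₂], continuousOn_Ico_of_tendsto ?_ e₂,
    hasDerivWithinAt_Ico_of_tendsto d₀ e₀ e₁, hasDerivWithinAt_Ico_of_tendsto d₁ e₁ e₂⟩
  have hc : ContinuousOn (fun x ↦ (x ^ 2 * m₂ x - 4 * x * m₁ x + 6 * m x) / x ^ 4)
      (Set.Ioo 0 b) := by
    have k₀ : ContinuousOn m (Set.Ioo 0 b) := HasDerivAt.continuousOn h₀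
    have k₁ : ContinuousOn m₁ (Set.Ioo 0 b) := HasDerivAt.continuousOn h₁
    have k₂ : ContinuousOn m₂ (Set.Ioo 0 b) := HasDerivAt.continuousOn h₂
    exact ContinuousOn.div (by fun_prop) (by fun_prop) fun x hx ↦ pow_ne_zero _ hx.1.ne'
  exact hc.congr fun x hx ↦ by simp [hf₂, hx.1.ne']

/-! ### Derivatives and strict convexity of the cumulant function -/

section CumulantDerivatives

variable {Ω : Type*} [MeasurableSpace Ω] {P : Measure Ω} {Y : Ω → ℝ} {b : ℝ}

theorem Ioo_subset_interior_integrableExpSet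
    (hexp : ∀ u ∈ Set.Ico 0 b, Integrable (fun ω ↦ Real.exp (u * Y ω)) P) :
    Set.Ioo 0 b ⊆ interior (integrableExpSet Y P) :=
  interior_maximal (fun u hu ↦ hexp u (Set.Ioo_subset_Ico_self hu)) isOpen_Ioo

/-- For `0 < u < b / 2` the exponential is dominated by `1 + exp (b / 2 * Y)`. The summand `1`
covers negative `Y` and is what calls for the polynomial moment. -/
theorem tendsto_integral_pow_mul_exp_nhdsGT_zero (hb : 0 < b) (hY : AEStronglyMeasurable Y P)
    (hexp : ∀ u ∈ Set.Ico 0 b, Integrable (fun ω ↦ Real.exp (u * Y ω)) P) {k : ℕ}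
    (hk : Integrable (fun ω ↦ |Y ω| ^ k) P) :
    Tendsto (fun u ↦ P[fun ω ↦ Y ω ^ k * Real.exp (u * Y ω)]) (𝓝[>] 0)
      (𝓝 (P[fun ω ↦ Y ω ^ k])) := by
  have hc : b / 2 ∈ Set.Ioo 0 b := ⟨by linarith, by linarith⟩
  have hint := integrable_pow_abs_mul_exp_of_mem_interior_integrableExpSet
    (Ioo_subset_interior_integrableExpSet hexp hc) k
  refine tendsto_integral_filter_of_dominated_convergence
    (fun ω ↦ |Y ω| ^ k + |Y ω| ^ k * Real.exp (b / 2 * Y ω)) ?_ ?_ (hk.add hint) ?_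
  · refine Eventually.of_forall fun u ↦ ?_
    exact (hY.pow k).mul (Real.continuous_exp.comp_aestronglyMeasurable (hY.const_mul u))
  · filter_upwards [Ioo_mem_nhdsGT hc.1] with u hu
    refine ae_of_all _ fun ω ↦ ?_
    rw [norm_mul, norm_pow, Real.norm_eq_abs, Real.norm_of_nonneg (Real.exp_pos _).le]
    have h1 : Real.exp (u * Y ω) ≤ 1 + Real.exp (b / 2 * Y ω) := by
      rcases le_total 0 (Y ω) with h | h
      · have : Real.exp (u * Y ω) ≤ Real.exp (b / 2 * Y ω) :=
          Real.exp_le_exp.2 (mul_le_mul_of_nonneg_right hu.2.le h)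
        linarith
      · have : Real.exp (u * Y ω) ≤ 1 :=
          Real.exp_le_one_iff.2 (mul_nonpos_of_nonneg_of_nonpos hu.1.le h)
        linarith [Real.exp_pos (b / 2 * Y ω)]
    calc |Y ω| ^ k * Real.exp (u * Y ω) ≤ |Y ω| ^ k * (1 + Real.exp (b / 2 * Y ω)) := by gcongr
      _ = _ := by ring
  · refine ae_of_all _ fun ω ↦ ?_
    have : Continuous fun u : ℝ ↦ Y ω ^ k * Real.exp (u * Y ω) := by fun_prop
    have h := this.tendsto 0
    simp only [zero_mul, Real.exp_zero, mul_one] at h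
    exact h.mono_left nhdsWithin_le_nhds

/-- The moments `A k` of the exponentially tilted law satisfy `A k' = A (k + 1) - A k * A 1`, so the
derivatives of the cumulant function are the classical cumulant polynomials in them. At `0` the
vanishing mean kills every term containing `A 1`. -/
theorem exists_derivs_quadQuotient_cgf [IsProbabilityMeasure P] (hb : 0 < b)
    (hY : AEStronglyMeasurable Y P)
    (hexp : ∀ u ∈ Set.Ico 0 b, Integrable (fun ω ↦ Real.exp (u * Y ω)) P)
    (hmom : ∀ k ≤ 4, Integrable (fun ω ↦ |Y ω| ^ k) P) (hmean : P[Y] = 0) :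
    ∃ f₁ f₂ : ℝ → ℝ, f₁ 0 = P[fun ω ↦ Y ω ^ 3] / 6 ∧
      f₂ 0 = (P[fun ω ↦ Y ω ^ 4] - 3 * P[fun ω ↦ Y ω ^ 2] ^ 2) / 12 ∧
      ContinuousOn f₂ (Set.Ico 0 b) ∧
      (∀ x ∈ Set.Ico 0 b, HasDerivWithinAt
        (quadQuotient (cgf Y P) (P[fun ω ↦ Y ω ^ 2] / 2)) (f₁ x) (Set.Ico 0 b) x) ∧
      (∀ x ∈ Set.Ico 0 b, HasDerivWithinAt f₁ (f₂ x) (Set.Ico 0 b) x) := by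
  set M : ℕ → ℝ → ℝ := fun k u ↦ P[fun ω ↦ Y ω ^ k * Real.exp (u * Y ω)] with hM
  have hd : ∀ k, ∀ x ∈ Set.Ioo 0 b, HasDerivAt (M k) (M (k + 1) x) x := fun k x hx ↦
    hasDerivAt_integral_pow_mul_exp_real (Ioo_subset_interior_integrableExpSet hexp hx) k
  have hl : ∀ k ≤ 4, Tendsto (M k) (𝓝[>] 0) (𝓝 (P[fun ω ↦ Y ω ^ k])) := fun k hk ↦
    tendsto_integral_pow_mul_exp_nhdsGT_zero hb hY hexp (hmom k hk)
  have hM0 : M 0 = mgf Y P := by ext u; simp [hM, mgf]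
  have hpos : ∀ x ∈ Set.Ioo 0 b, M 0 x ≠ 0 := fun x hx ↦ by
    rw [hM0]; exact (mgf_pos (hexp x (Set.Ioo_subset_Ico_self hx))).ne'
  set A : ℕ → ℝ → ℝ := fun k x ↦ M k x / M 0 x with hA
  have ha : ∀ k, ∀ x ∈ Set.Ioo 0 b, HasDerivAt (A k) (A (k + 1) x - A k x * A 1 x) x := by
    intro k x hx
    have h0 := hpos x hx
    convert! (hd k x hx).div (hd 0 x hx) h0 using 1
    simp only [hA]; field_simp
  have l0 : Tendsto (M 0) (𝓝[>] 0) (𝓝 1) := by simpa using hl 0 (by norm_num)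
  have la : ∀ k ≤ 4, Tendsto (A k) (𝓝[>] 0) (𝓝 (P[fun ω ↦ Y ω ^ k])) := fun k hk ↦ by
    have := (hl k hk).div l0 one_ne_zero
    rwa [div_one] at this
  have la1 : Tendsto (A 1) (𝓝[>] 0) (𝓝 0) := by
    have := la 1 (by norm_num)
    simp only [pow_one] at this
    rwa [hmean] at this
  have la2 := la 2 (by norm_num)
  have la3 := la 3 (by norm_num)
  have la4 := la 4 (by norm_num)
  refine exists_derivs_quadQuotient (m := cgf Y P) (m₁ := A 1)
    (m₂ := fun x ↦ A 2 x - A 1 x ^ 2)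
    (m₃ := fun x ↦ A 3 x - 3 * A 1 x * A 2 x + 2 * A 1 x ^ 3)
    (m₄ := fun x ↦ A 4 x - 4 * A 1 x * A 3 x - 3 * A 2 x ^ 2 + 12 * A 1 x ^ 2 * A 2 x
      - 6 * A 1 x ^ 4) hb ?_ ?_ ?_ ?_ ?_ la1 ?_ ?_ ?_
  · intro x hx
    have h0 := hpos x hx
    have := (hd 0 x hx).log h0
    rw [hM0] at this
    simp only [hA, hM0]
    exact this
  · intro x hx
    convert! ha 1 x hx using 1
    ring
  · intro x hx
    convert! (ha 2 x hx).sub ((ha 1 x hx).pow 2) using 1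
    push_cast; ring
  · intro x hx
    convert! ((ha 3 x hx).sub (((ha 1 x hx).const_mul 3).mul (ha 2 x hx))).add
      (((ha 1 x hx).pow 3).const_mul 2) using 1
    push_cast; ring
  · have := l0.log one_ne_zero
    rw [hM0, Real.log_one] at this
    exact this
  · simpa using la2.sub (la1.pow 2)
  · simpa using (la3.sub ((la1.const_mul 3).mul la2)).add ((la1.pow 3).const_mul 2)
  · simpa using (((la4.sub ((la1.const_mul 4).mul la3)).sub ((la2.pow 2).const_mul 3)).add
      (((la1.pow 2).const_mul 12).mul la2)).sub ((la1.pow 4).const_mul 6)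

/-- The variance `mgf (2 * x) - mgf x ^ 2` of `exp (x * Y)` is positive, since otherwise `Y` would
be almost surely constant; take logarithms. -/
theorem two_mul_cgf_lt_cgf_two_mul [IsProbabilityMeasure P] {x : ℝ} (hx : x ≠ 0)
    (hY : AEMeasurable Y P) (hexp : Integrable (fun ω ↦ Real.exp (2 * x * Y ω)) P)
    (hvar : variance Y P ≠ 0) : 2 * cgf Y P x < cgf Y P (2 * x) := by
  set Z : Ω → ℝ := fun ω ↦ Real.exp (x * Y ω) with hZ
  have hZm : AEMeasurable Z P := by fun_prop
  have hsq : ∀ ω, Z ω ^ 2 = Real.exp (2 * x * Y ω) := fun ω ↦ by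
    rw [hZ, ← Real.exp_nat_mul]; push_cast; ring_nf
  have hL2 : MemLp Z 2 P := by
    rw [memLp_two_iff_integrable_sq hZm.aestronglyMeasurable]
    exact hexp.congr (ae_of_all _ fun ω ↦ (hsq ω).symm)
  have hZint : Integrable (fun ω ↦ Real.exp (x * Y ω)) P := hL2.integrable (by norm_num)
  have hne : variance Z P ≠ 0 := by
    intro h0
    have hconst := ae_eq_integral_of_variance_eq_zero hL2 h0
    apply hvar
    have : Y =ᵐ[P] fun _ ↦ Real.log (P[Z]) / x := by
      filter_upwards [hconst] with ω hω
      rw [← hω, hZ, Real.log_exp]; field_simp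
    rw [variance_congr this, variance_eq_integral (by fun_prop)]
    simp
  have hpos : 0 < variance Z P := lt_of_le_of_ne (variance_nonneg _ _) hne.symm
  rw [variance_eq_sub hL2] at hpos
  have h1 : P[Z ^ 2] = mgf Y P (2 * x) := integral_congr_ae (ae_of_all _ hsq)
  have h2 : P[Z] = mgf Y P x := rfl
  rw [h1, h2] at hpos
  have hp := mgf_pos hZint
  have := Real.log_lt_log (by positivity) (sub_pos.1 hpos)
  rw [Real.log_pow] at this
  simpa [cgf] using this

end CumulantDerivatives

/-! ### Cumulants along the curve at real arguments -/

section RealCumulants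

variable {Ω Ω' : Type*} [MeasurableSpace Ω] [MeasurableSpace Ω'] {P : Measure Ω}
  {P' : Measure Ω'}

theorem cumulantGenFun_ofReal {Y : ℝ≥0 → Ω → ℝ} {u w : ℝ}
    (hint : Integrable (fun ω ↦ Real.exp (u * Y 1 ω)) P)
    (h : ∀ t : ℝ≥0, mgf (Y t) P u = Real.exp (t * w)) :
    cumulantGenFun Y P (u : ℂ) = w := by
  have hw : ∀ t : ℝ≥0, ∫ ω, Complex.exp ((u : ℂ) * (Y t ω : ℂ)) ∂P =
      Complex.exp ((t : ℂ) * (w : ℂ)) := by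
    intro t
    have h1 := congrArg (fun r : ℝ ↦ (r : ℂ)) (h t)
    simp only [mgf, ← integral_complex_ofReal] at h1
    push_cast at h1
    exact h1
  have hex : (u : ℂ) ∈ expDomain Y P ∧ ∃ w : ℂ, ∀ t : ℝ≥0,
      ∫ ω, Complex.exp ((u : ℂ) * (Y t ω : ℂ)) ∂P = Complex.exp ((t : ℂ) * w) :=
    ⟨by simpa [expDomain] using hint, w, hw⟩
  rw [cumulantGenFun, dif_pos hex]
  exact eq_of_exp_mul_eq fun t ↦ by rw [← hex.2.choose_spec t, hw t]

theorem cumulantGenFun_levyCurve [IsProbabilityMeasure P] {X : ℝ≥0 → Ω → ℝ}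
    (hX : IsLevyProcess X P) {l u : ℝ} (hl : 0 < l)
    (hint : Integrable (fun ω ↦ Real.exp (u * l * X 1 ω)) P) :
    cumulantGenFun (levyCurve X P l) P (u : ℂ) =
      (u * (1 - 1 / l) * driftRate X P + cgf (X 1) P (u * l) / l ^ 2 : ℝ) := by
  have hexp : ∀ t ω, Real.exp (u * levyCurve X P l t ω) =
      Real.exp (u * ((1 - 1 / l) * driftRate X P * t)) *
        Real.exp (u * l * X (t / (Real.toNNReal l) ^ 2) ω) := fun t ω ↦ by
    rw [← Real.exp_add, levyCurve]; ring_nf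
  refine cumulantGenFun_ofReal ?_ fun t ↦ ?_
  · simp only [hexp]
    exact (hX.integrable_exp hint _).const_mul _
  · have h1 := hX.mgf_eq_exp hint (t / (Real.toNNReal l) ^ 2)
    simp only [mgf] at h1 ⊢
    simp only [hexp, integral_const_mul, h1]
    rw [← Real.exp_add]
    congr 1
    rw [NNReal.coe_div, NNReal.coe_pow, Real.coe_toNNReal l hl.le]
    ring

theorem cumulantGenFun_brownianLimit (X : ℝ≥0 → Ω → ℝ) {W : ℝ≥0 → Ω' → ℝ}
    (hW : IsPreBrownianReal W P') (u : ℝ) :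
    cumulantGenFun (brownianLimit X P W) P' (u : ℂ) =
      (u * driftRate X P + u ^ 2 * (volatility X P ^ 2 / 2) : ℝ) := by
  have hexp : ∀ t ω, Real.exp (u * brownianLimit X P W t ω) =
      Real.exp (u * (driftRate X P * t)) * Real.exp (u * volatility X P * W t ω) := fun t ω ↦ by
    rw [← Real.exp_add, brownianLimit]; ring_nf
  refine cumulantGenFun_ofReal ?_ fun t ↦ ?_
  · simp only [hexp]
    refine Integrable.const_mul ?_ _
    have h := integrable_exp_mul_gaussianReal (μ := 0) (v := 1) (u * volatility X P)
    rw [← (hW.hasLaw_eval 1).map_eq] at h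
    exact h.comp_aemeasurable (hW.aemeasurable 1)
  · have h1 := mgf_gaussianReal (hW.hasLaw_eval t).map_eq (u * volatility X P)
    simp only [mgf] at h1 ⊢
    simp only [hexp, integral_const_mul, h1]
    rw [← Real.exp_add]
    congr 1
    ring

theorem cgf_sub_const {Y : Ω → ℝ} [IsProbabilityMeasure P] {v : ℝ}
    (hint : Integrable (fun ω ↦ Real.exp (v * Y ω)) P) (c : ℝ) :
    cgf (fun ω ↦ Y ω - c) P v = cgf Y P v - v * c := by
  have h1 : mgf (fun ω ↦ Y ω - c) P v = mgf Y P v * Real.exp (-(v * c)) := by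
    simp only [mgf]
    rw [← integral_mul_const]
    refine integral_congr_ae (ae_of_all _ fun ω ↦ ?_)
    simp only
    rw [← Real.exp_add]; ring_nf
  rw [cgf, h1, Real.log_mul (mgf_pos hint).ne' (Real.exp_pos _).ne', Real.log_exp, cgf]
  ring

/-- The function `(κ(x) - μ x) / x²` on the real axis, extended to `0` by `σ² / 2`, where `κ` is
the cumulant generating function of `X`. -/
noncomputable def centeredQuotient (X : ℝ≥0 → Ω → ℝ) (P : Measure Ω) : ℝ → ℝ :=
  quadQuotient (cgf (fun ω ↦ X 1 ω - driftRate X P) P) (volatility X P ^ 2 / 2)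

/-- The drift correction `-u μ / l` is exactly the centring of `κ (u l) / l ^ 2`. The value chosen
for the quotient at `0` makes the Brownian limit obey the same formula. -/
theorem curveCumulant_ofReal [IsProbabilityMeasure P] {X : ℝ≥0 → Ω → ℝ}
    (hX : IsLevyProcess X P) {W : ℝ≥0 → Ω' → ℝ} (hW : IsPreBrownianReal W P') {l u : ℝ}
    (hl : 0 ≤ l) (hu : u ≠ 0) (hint : Integrable (fun ω ↦ Real.exp (u * l * X 1 ω)) P) :
    curveCumulant X P W P' l (u : ℂ) =
      (u * driftRate X P + u ^ 2 * centeredQuotient X P (u * l) : ℝ) := by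
  rcases hl.eq_or_lt with rfl | hl0
  · rw [curveCumulant, if_pos rfl, cumulantGenFun_brownianLimit X hW]
    simp [centeredQuotient, quadQuotient]
  · rw [curveCumulant, if_neg hl0.ne', cumulantGenFun_levyCurve hX hl0 hint]
    have hne : u * l ≠ 0 := mul_ne_zero hu hl0.ne'
    rw [centeredQuotient, quadQuotient, if_neg hne, cgf_sub_const hint]
    congr 1
    field_simp
    ring

theorem meanVarianceRatio_eq [IsProbabilityMeasure P] {X : ℝ≥0 → Ω → ℝ}
    (hX : IsLevyProcess X P) {W : ℝ≥0 → Ω' → ℝ} (hW : IsPreBrownianReal W P') {l : ℝ}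
    (hl : 0 ≤ l) (hint : Integrable (fun ω ↦ Real.exp (2 * l * X 1 ω)) P) :
    meanVarianceRatio X P W P' l =
      ((driftRate X P + centeredQuotient X P l) /
        (4 * centeredQuotient X P (2 * l) - 2 * centeredQuotient X P l) : ℝ) := by
  have hint1 : Integrable (fun ω ↦ Real.exp (1 * l * X 1 ω)) P :=
    integrable_exp_mul_of_nonneg_of_le hint (by linarith) (by linarith)
  have h1 := curveCumulant_ofReal hX hW hl one_ne_zero hint1
  have h2 := curveCumulant_ofReal hX hW hl two_ne_zero hint
  simp only [Complex.ofReal_one, one_mul, one_pow, Complex.ofReal_ofNat] at h1 h2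
  rw [meanVarianceRatio, kappaBar, one_add_one_eq_two, h1, h2]
  push_cast
  congr 1
  ring

end RealCumulants

/-! ### Second derivatives on half-open intervals -/

section TwoDerivatives

theorem contDiffOn_two_of_hasDerivWithinAt {E : Type*} [NormedAddCommGroup E] [NormedSpace ℝ E]
    {f f₁ f₂ : ℝ → E} {s : Set ℝ} (hs : UniqueDiffOn ℝ s)
    (h₁ : ∀ x ∈ s, HasDerivWithinAt f (f₁ x) s x)
    (h₂ : ∀ x ∈ s, HasDerivWithinAt f₁ (f₂ x) s x) (hc : ContinuousOn f₂ s) :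
    ContDiffOn ℝ 2 f s := by
  have e₁ : ∀ x ∈ s, derivWithin f s x = f₁ x := fun x hx ↦ (h₁ x hx).derivWithin (hs x hx)
  have e₂ : ∀ x ∈ s, derivWithin f₁ s x = f₂ x := fun x hx ↦ (h₂ x hx).derivWithin (hs x hx)
  have c₁ : ContDiffOn ℝ 1 f₁ s := by
    rw [← zero_add (1 : WithTop ℕ∞), contDiffOn_succ_iff_derivWithin hs]
    exact ⟨fun x hx ↦ (h₂ x hx).differentiableWithinAt, by simp,
      contDiffOn_zero.2 (hc.congr e₂)⟩
  rw [← one_add_one_eq_two, contDiffOn_succ_iff_derivWithin hs]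
  exact ⟨fun x hx ↦ (h₁ x hx).differentiableWithinAt, by simp, c₁.congr e₁⟩

/-- Derivatives within a set are local, so nothing is needed at the right endpoint, where
differentiability may fail. -/
theorem iteratedDerivWithin_Icc_left_of_hasDerivWithinAt_Ico {E : Type*} [NormedAddCommGroup E]
    [NormedSpace ℝ E] {f f₁ f₂ : ℝ → E} {a b : ℝ} (hab : a < b)
    (h₁ : ∀ x ∈ Set.Ico a b, HasDerivWithinAt f (f₁ x) (Set.Ico a b) x)
    (h₂ : HasDerivWithinAt f₁ (f₂ a) (Set.Ico a b) a) :
    iteratedDerivWithin 1 f (Set.Icc a b) a = f₁ a ∧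
      iteratedDerivWithin 2 f (Set.Icc a b) a = f₂ a := by
  have hu := uniqueDiffOn_Icc hab
  have hnhds : ∀ x ∈ Set.Ico a b, Set.Ico a b ∈ 𝓝[Set.Icc a b] x := fun x hx ↦ by
    filter_upwards [self_mem_nhdsWithin, mem_nhdsWithin_of_mem_nhds (Iio_mem_nhds hx.2)]
      with y hy hy' using ⟨hy.1, hy'⟩
  have ha : a ∈ Set.Ico a b := ⟨le_rfl, hab⟩
  have e₁ : ∀ x ∈ Set.Ico a b, derivWithin f (Set.Icc a b) x = f₁ x := fun x hx ↦
    ((h₁ x hx).mono_of_mem_nhdsWithin (hnhds x hx)).derivWithin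
      (hu x (Set.Ico_subset_Icc_self hx))
  refine ⟨by rw [iteratedDerivWithin_one, e₁ a ha], ?_⟩
  rw [iteratedDerivWithin_succ]
  have h3 : HasDerivWithinAt (derivWithin f (Set.Icc a b)) (f₂ a) (Set.Icc a b) a := by
    refine (h₂.mono_of_mem_nhdsWithin (hnhds a ha)).congr_of_eventuallyEq ?_ (e₁ a ha)
    filter_upwards [hnhds a ha] with x hx using e₁ x hx
  rw [iteratedDerivWithin_one]
  exact h3.derivWithin (hu a ⟨le_rfl, hab.le⟩)

/-- The formulas come from differentiating `N = q * D` twice and solving for the top derivative of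
`q`. -/
theorem exists_derivs_div {N N₁ N₂ D D₁ D₂ : ℝ → ℝ} {s : Set ℝ}
    (hN : ∀ x ∈ s, HasDerivWithinAt N (N₁ x) s x) (hN₁ : ∀ x ∈ s, HasDerivWithinAt N₁ (N₂ x) s x)
    (hN₂ : ContinuousOn N₂ s)
    (hD : ∀ x ∈ s, HasDerivWithinAt D (D₁ x) s x) (hD₁ : ∀ x ∈ s, HasDerivWithinAt D₁ (D₂ x) s x)
    (hD₂ : ContinuousOn D₂ s) (hne : ∀ x ∈ s, D x ≠ 0) :
    ∃ q₁ q₂ : ℝ → ℝ, (∀ x ∈ s, q₁ x = (N₁ x - N x / D x * D₁ x) / D x) ∧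
      (∀ x ∈ s, q₂ x = (N₂ x - 2 * q₁ x * D₁ x - N x / D x * D₂ x) / D x) ∧
      ContinuousOn q₂ s ∧ (∀ x ∈ s, HasDerivWithinAt (fun x ↦ N x / D x) (q₁ x) s x) ∧
      (∀ x ∈ s, HasDerivWithinAt q₁ (q₂ x) s x) := by
  have d₀ : ∀ x ∈ s, HasDerivWithinAt (fun x ↦ N x / D x)
      ((N₁ x - N x / D x * D₁ x) / D x) s x := fun x hx ↦ by
    have := hne x hx
    convert! (hN x hx).div (hD x hx) this using 1
    field_simp
  have d₁ : ∀ x ∈ s, HasDerivWithinAt (fun x ↦ (N₁ x - N x / D x * D₁ x) / D x)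
      ((N₂ x - 2 * ((N₁ x - N x / D x * D₁ x) / D x) * D₁ x - N x / D x * D₂ x) / D x) s x :=
    fun x hx ↦ by
    have := hne x hx
    convert! ((hN₁ x hx).sub ((d₀ x hx).mul (hD₁ x hx))).div (hD x hx) this using 1
    simp only [Pi.sub_apply, Pi.mul_apply]
    field_simp
    ring
  refine ⟨_, _, fun x _ ↦ rfl, fun x _ ↦ rfl, ?_, d₀, d₁⟩
  have k₀ : ContinuousOn N s := fun x hx ↦ (hN x hx).continuousWithinAt
  have k₁ : ContinuousOn N₁ s := fun x hx ↦ (hN₁ x hx).continuousWithinAt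
  have k₂ : ContinuousOn D s := fun x hx ↦ (hD x hx).continuousWithinAt
  have k₃ : ContinuousOn D₁ s := fun x hx ↦ (hD₁ x hx).continuousWithinAt
  fun_prop (disch := assumption)

end TwoDerivatives

/-! ### Regularity and derivatives of the mean-variance ratio -/

section MeanVarianceRatio

variable {Ω Ω' : Type*} [MeasurableSpace Ω] [MeasurableSpace Ω'] {P : Measure Ω}
  {P' : Measure Ω'} {X : ℝ≥0 → Ω → ℝ}

theorem integrable_exp_mul_sub_const {Y : Ω → ℝ} {u : ℝ}
    (h : Integrable (fun ω ↦ Real.exp (u * Y ω)) P) (c : ℝ) :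
    Integrable (fun ω ↦ Real.exp (u * (Y ω - c))) P := by
  refine (h.mul_const (Real.exp (-(u * c)))).congr (ae_of_all _ fun ω ↦ ?_)
  simp only
  rw [← Real.exp_add]; ring_nf

theorem volatility_sq : volatility X P ^ 2 = variance (X 1) P :=
  Real.sq_sqrt (variance_nonneg _ _)

theorem centeredQuotient_zero : centeredQuotient X P 0 = volatility X P ^ 2 / 2 := by
  simp [centeredQuotient, quadQuotient]

theorem exists_gt_integrable_exp_of_mem_interior_expDomain {Y : ℝ≥0 → Ω → ℝ} {a : ℝ}
    (ha : (a : ℂ) ∈ interior (expDomain Y P)) :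
    ∃ b > a, Integrable (fun ω ↦ Real.exp (b * Y 1 ω)) P := by
  have h1 : ∀ᶠ x : ℝ in 𝓝 a, (x : ℂ) ∈ expDomain Y P :=
    Complex.continuous_ofReal.continuousAt.eventually (mem_interior_iff_mem_nhds.1 ha)
  obtain ⟨b, hb, hab⟩ := ((h1.filter_mono nhdsWithin_le_nhds).and
    (self_mem_nhdsWithin (s := Set.Ioi a))).exists
  exact ⟨b, hab, by simpa [expDomain] using hb⟩

variable [IsProbabilityMeasure P]

theorem exists_derivs_centeredQuotient (hX : IsLevyProcess X P) (hmom : MomentConditions X P)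
    {b : ℝ} (hb : 0 < b)
    (hexp : ∀ u ∈ Set.Ico 0 b, Integrable (fun ω ↦ Real.exp (u * X 1 ω)) P) :
    ∃ f₁ f₂ : ℝ → ℝ, f₁ 0 = skewness (X 1) P * volatility X P ^ 3 / 6 ∧
      f₂ 0 = excessKurtosis (X 1) P * volatility X P ^ 4 / 12 ∧
      ContinuousOn f₂ (Set.Ico 0 b) ∧
      (∀ x ∈ Set.Ico 0 b, HasDerivWithinAt (centeredQuotient X P) (f₁ x) (Set.Ico 0 b) x) ∧
      (∀ x ∈ Set.Ico 0 b, HasDerivWithinAt f₁ (f₂ x) (Set.Ico 0 b) x) := by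
  have hXm := hX.measurable 1
  have hσ : 0 < volatility X P := Real.sqrt_pos.2 hmom.variance_pos
  have hX4 : MemLp (X 1) 4 P := by
    have := hmom.moments 4 (by simp)
    rw [← integrable_norm_rpow_iff hXm.aestronglyMeasurable (by norm_num) (by norm_num)]
    refine this.congr (ae_of_all _ fun ω ↦ ?_)
    simp only [ENNReal.toReal_ofNat, Real.norm_eq_abs]
    exact (Real.rpow_natCast _ 4).symm
  have hY4 : MemLp (fun ω ↦ X 1 ω - driftRate X P) 4 P := hX4.sub (memLp_const _)
  have hmean : P[fun ω ↦ X 1 ω - driftRate X P] = 0 := by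
    rw [integral_sub (hX4.integrable (by norm_num)) (integrable_const _)]
    simp [driftRate]
  have h2 : P[fun ω ↦ (X 1 ω - driftRate X P) ^ 2] = volatility X P ^ 2 := by
    rw [volatility_sq, variance_eq_integral hXm.aemeasurable]; rfl
  have h3 : P[fun ω ↦ (X 1 ω - driftRate X P) ^ 3] =
      skewness (X 1) P * volatility X P ^ 3 := by
    change _ = _ / volatility X P ^ 3 * _
    rw [div_mul_cancel₀ _ (pow_ne_zero 3 hσ.ne')]; rfl
  -- The `3` will cancel against `3 * σ ^ 4` in the fourth cumulant.
  have h4 : P[fun ω ↦ (X 1 ω - driftRate X P) ^ 4] =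
      (excessKurtosis (X 1) P + 3) * volatility X P ^ 4 := by
    change _ = (_ / volatility X P ^ 4 - 3 + 3) * _
    rw [sub_add_cancel, div_mul_cancel₀ _ (pow_ne_zero 4 hσ.ne')]; rfl
  have h := exists_derivs_quadQuotient_cgf hb (hXm.sub_const (driftRate X P)).aestronglyMeasurable
    (fun u hu ↦ integrable_exp_mul_sub_const (hexp u hu) (driftRate X P))
    (fun k hk ↦ by
      have : MemLp (fun ω ↦ X 1 ω - driftRate X P) k P :=
        hY4.mono_exponent (by exact_mod_cast hk)
      simpa using this.integrable_norm_pow') hmean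
  rw [h2, h3, h4] at h
  obtain ⟨f₁, f₂, h5, h6, h7⟩ := h
  exact ⟨f₁, f₂, h5, by rw [h6]; ring, h7⟩

theorem centeredQuotient_denominator_pos (hX : IsLevyProcess X P) (hmom : MomentConditions X P)
    {l : ℝ} (hl : 0 ≤ l) (hint : Integrable (fun ω ↦ Real.exp (2 * l * X 1 ω)) P) :
    0 < 4 * centeredQuotient X P (2 * l) - 2 * centeredQuotient X P l := by
  have hvar := hmom.variance_pos
  rcases hl.eq_or_lt with rfl | hl0
  · rw [mul_zero, centeredQuotient_zero, volatility_sq]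
    linarith
  · have hXm := hX.measurable 1
    have h := two_mul_cgf_lt_cgf_two_mul hl0.ne'
      (hXm.sub_const (driftRate X P)).aemeasurable
      (integrable_exp_mul_sub_const hint (driftRate X P))
      (by rw [variance_sub_const hXm.aestronglyMeasurable]; exact hvar.ne')
    simp only [centeredQuotient, quadQuotient, if_neg hl0.ne',
      if_neg (mul_pos two_pos hl0).ne']
    have hl2 : 0 < l ^ 2 := by positivity
    calc (0 : ℝ) < (cgf (fun ω ↦ X 1 ω - driftRate X P) P (2 * l) -
          2 * cgf (fun ω ↦ X 1 ω - driftRate X P) P l) / l ^ 2 := div_pos (by linarith) hl2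
      _ = _ := by field_simp; ring

/-- With `D x = 4 F (2 x) - 2 F x` one has `D 0 = σ ^ 2`, `D' 0 = 6 F' 0` and `D'' 0 = 14 F'' 0`.
The argument `2 x` halves the interval. -/
theorem exists_derivs_meanVarianceRatio (hX : IsLevyProcess X P) (hmom : MomentConditions X P)
    {W : ℝ≥0 → Ω' → ℝ} (hW : IsPreBrownianReal W P') {b : ℝ} (hb : 0 < b)
    (hexp : ∀ u ∈ Set.Ico 0 b, Integrable (fun ω ↦ Real.exp (u * X 1 ω)) P) :
    ∃ q₁ q₂ : ℝ → ℝ,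
      q₁ 0 = (skewness (X 1) P * volatility X P ^ 3 / 6
        - (driftRate X P + volatility X P ^ 2 / 2) / volatility X P ^ 2
          * (skewness (X 1) P * volatility X P ^ 3)) / volatility X P ^ 2 ∧
      q₂ 0 = (excessKurtosis (X 1) P * volatility X P ^ 4 / 12
        - 2 * q₁ 0 * (skewness (X 1) P * volatility X P ^ 3)
        - (driftRate X P + volatility X P ^ 2 / 2) / volatility X P ^ 2
          * (7 / 6 * (excessKurtosis (X 1) P * volatility X P ^ 4))) / volatility X P ^ 2 ∧
      ContinuousOn q₂ (Set.Ico 0 (b / 2)) ∧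
      (∀ x ∈ Set.Ico 0 (b / 2), HasDerivWithinAt (meanVarianceRatio X P W P') (q₁ x)
        (Set.Ico 0 (b / 2)) x) ∧
      (∀ x ∈ Set.Ico 0 (b / 2), HasDerivWithinAt q₁ (q₂ x) (Set.Ico 0 (b / 2)) x) := by
  obtain ⟨f₁, f₂, hf₁, hf₂, hc, hd, hd₁⟩ := exists_derivs_centeredQuotient hX hmom hb hexp
  set s : Set ℝ := Set.Ico 0 (b / 2) with hs
  set F := centeredQuotient X P with hF
  have hsub : s ⊆ Set.Ico 0 b := fun x hx ↦ ⟨hx.1, by linarith [hx.2, hx.1]⟩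
  have hmap : Set.MapsTo (fun x : ℝ ↦ 2 * x) s (Set.Ico 0 b) := fun x hx ↦
    ⟨by linarith [hx.1], by linarith [hx.2]⟩
  have h0 : (0 : ℝ) ∈ s := ⟨le_rfl, by linarith⟩
  have hscale : ∀ {g g' : ℝ → ℝ},
      (∀ x ∈ Set.Ico 0 b, HasDerivWithinAt g (g' x) (Set.Ico 0 b) x) →
      ∀ x ∈ s, HasDerivWithinAt (fun x ↦ g (2 * x)) (2 * g' (2 * x)) s x := by
    intro g g' hg x hx
    have h2 : HasDerivWithinAt (fun x : ℝ ↦ 2 * x) 2 s x := by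
      simpa using ((hasDerivAt_id x).const_mul 2).hasDerivWithinAt
    have := (hg _ (hmap hx)).comp x h2 hmap
    rwa [mul_comm] at this
  have hN : ∀ x ∈ s, HasDerivWithinAt (fun x ↦ driftRate X P + F x) (f₁ x) s x := fun x hx ↦
    ((hd x (hsub hx)).mono hsub).const_add _
  have hN₁ : ∀ x ∈ s, HasDerivWithinAt f₁ (f₂ x) s x := fun x hx ↦ (hd₁ x (hsub hx)).mono hsub
  have hD : ∀ x ∈ s, HasDerivWithinAt (fun x ↦ 4 * F (2 * x) - 2 * F x)
      (8 * f₁ (2 * x) - 2 * f₁ x) s x := fun x hx ↦ by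
    convert! ((hscale hd x hx).const_mul 4).sub (((hd x (hsub hx)).mono hsub).const_mul 2) using 1
    ring
  have hD₁ : ∀ x ∈ s, HasDerivWithinAt (fun x ↦ 8 * f₁ (2 * x) - 2 * f₁ x)
      (16 * f₂ (2 * x) - 2 * f₂ x) s x := fun x hx ↦ by
    convert! ((hscale hd₁ x hx).const_mul 8).sub ((hN₁ x hx).const_mul 2) using 1
    ring
  have hD₂ : ContinuousOn (fun x ↦ 16 * f₂ (2 * x) - 2 * f₂ x) s := by
    have h1 : ContinuousOn (fun x ↦ f₂ (2 * x)) s := hc.comp (by fun_prop) hmap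
    exact (h1.const_mul 16).sub ((hc.mono hsub).const_mul 2)
  have hint : ∀ x ∈ s, Integrable (fun ω ↦ Real.exp (2 * x * X 1 ω)) P := fun x hx ↦
    hexp _ (hmap hx)
  obtain ⟨q₁, q₂, hq₁, hq₂, hqc, hqd, hqd₁⟩ := exists_derivs_div hN hN₁ (hc.mono hsub) hD hD₁ hD₂
    fun x hx ↦ (centeredQuotient_denominator_pos hX hmom hx.1 (hint x hx)).ne'
  have hF0 : F 0 = volatility X P ^ 2 / 2 := centeredQuotient_zero
  refine ⟨q₁, q₂, ?_, ?_, hqc, fun x hx ↦ ?_, hqd₁⟩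
  · rw [hq₁ 0 h0, mul_zero, hF0, hf₁]; ring_nf
  · rw [hq₂ 0 h0, mul_zero, hF0, hf₁, hf₂]; ring_nf
  · refine (hqd x hx).ofReal_comp.congr (fun y hy ↦ ?_) ?_
    · exact meanVarianceRatio_eq hX hW hy.1 (hint y hy)
    · exact meanVarianceRatio_eq hX hW hx.1 (hint x hx)

theorem contDiffOn_two_meanVarianceRatio (hX : IsLevyProcess X P) (hmom : MomentConditions X P)
    {W : ℝ≥0 → Ω' → ℝ} (hW : IsPreBrownianReal W P') {b : ℝ} (hb : 0 < b)
    (hexp : ∀ u ∈ Set.Ico 0 b, Integrable (fun ω ↦ Real.exp (u * X 1 ω)) P) :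
    ContDiffOn ℝ 2 (meanVarianceRatio X P W P') (Set.Ico 0 (b / 2)) := by
  obtain ⟨q₁, q₂, -, -, hc, hd, hd₁⟩ := exists_derivs_meanVarianceRatio hX hmom hW hb hexp
  exact contDiffOn_two_of_hasDerivWithinAt (uniqueDiffOn_Ico _ _) hd
    (fun x hx ↦ (hd₁ x hx).ofReal_comp) (Complex.continuous_ofReal.comp_continuousOn hc)

end MeanVarianceRatio

/-! ### The second-order approximation -/

theorem lemma3p5 {Ω Ω' : Type*} [MeasurableSpace Ω] [MeasurableSpace Ω']
    (P : Measure Ω) [IsProbabilityMeasure P] (P' : Measure Ω') [IsProbabilityMeasure P']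
    (X : ℝ≥0 → Ω → ℝ) (hX : IsLevyProcess X P) (hmom : MomentConditions X P)
    (W : ℝ≥0 → Ω' → ℝ) (hW : IsBrownianReal W P')
    (μ σ Skew ExKurt Λ₀ Λ₁ Λ₂ : ℝ)
    (hμ : μ = driftRate X P) (hσ : σ = volatility X P)
    (hSkew : Skew = skewness (X 1) P) (hExKurt : ExKurt = excessKurtosis (X 1) P)
    (hΛ₀ : Λ₀ = (μ + σ ^ 2 / 2) / σ ^ 2)
    (hΛ₁ : Λ₁ = Skew * σ * (1 / 6 - Λ₀))
    (hΛ₂ : Λ₂ = Skew ^ 2 * σ ^ 2 * (2 * Λ₀ - 1 / 3)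
      + 1 / 6 * ExKurt * σ ^ 2 * (1 / 2 - 7 * Λ₀)) :
    ContDiffOn ℝ 2 (meanVarianceRatio X P W P') (Set.Ico 0 1) ∧
    ((2 : ℂ) ∈ interior (expDomain X P) →
      ContDiffOn ℝ 2 (meanVarianceRatio X P W P') (Set.Icc 0 1)) ∧
    approxTerm (meanVarianceRatio X P W P') 0 = Λ₀ ∧
    approxTerm (meanVarianceRatio X P W P') 1 = Λ₁ ∧
    approxTerm (meanVarianceRatio X P W P') 2 = Λ₂ ∧
    secondOrderApprox (meanVarianceRatio X P W P') = Λ₀ + Λ₁ + 1 / 2 * Λ₂ := by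
  have hexp : ∀ {b : ℝ}, Integrable (fun ω ↦ Real.exp (b * X 1 ω)) P →
      ∀ u ∈ Set.Ico 0 b, Integrable (fun ω ↦ Real.exp (u * X 1 ω)) P := fun hb u hu ↦
    integrable_exp_mul_of_nonneg_of_le hb hu.1 hu.2.le
  have hW' := hW.toIsPreBrownianReal
  have hσ0 : σ ≠ 0 := by rw [hσ]; exact (Real.sqrt_pos.2 hmom.variance_pos).ne'
  obtain ⟨q₁, q₂, hq₁, hq₂, -, hd, hd₁⟩ :=
    exists_derivs_meanVarianceRatio hX hmom hW' two_pos (hexp hmom.expMoment)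
  rw [div_self two_ne_zero] at hd hd₁
  rw [← hμ, ← hσ, ← hSkew, ← hΛ₀] at hq₁
  rw [← hμ, ← hσ, ← hSkew, ← hExKurt, ← hΛ₀] at hq₂
  have hq₁' : q₁ 0 = Λ₁ := by rw [hq₁, hΛ₁]; field_simp
  have hq₂' : q₂ 0 = Λ₂ := by rw [hq₂, hq₁', hΛ₁, hΛ₂]; field_simp; ring
  have t₀ : approxTerm (meanVarianceRatio X P W P') 0 = Λ₀ := by
    rw [approxTerm, iteratedDerivWithin_zero, meanVarianceRatio_eq hX hW' le_rfl (by simp),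
      mul_zero, centeredQuotient_zero, ← hμ, ← hσ, hΛ₀]
    congr 2
    ring
  obtain ⟨t₁, t₂⟩ := iteratedDerivWithin_Icc_left_of_hasDerivWithinAt_Ico zero_lt_one hd
    (f₂ := fun x ↦ (q₂ x : ℂ)) (hd₁ 0 ⟨le_rfl, zero_lt_one⟩).ofReal_comp
  rw [hq₁'] at t₁
  simp only [hq₂'] at t₂
  refine ⟨?_, fun h2 ↦ ?_, t₀, t₁, t₂, ?_⟩
  · have := contDiffOn_two_meanVarianceRatio hX hmom hW' two_pos (hexp hmom.expMoment)
    rwa [div_self two_ne_zero] at this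
  -- An exponential moment of order `b > 2` gives regularity on `[0, b / 2)`, which contains `[0,
  -- 1]`.
  · obtain ⟨b, hb, hint⟩ := exists_gt_integrable_exp_of_mem_interior_expDomain (a := 2)
      (by simpa using h2)
    refine (contDiffOn_two_meanVarianceRatio hX hmom hW' (two_pos.trans hb) (hexp hint)).mono
      fun x hx ↦ ⟨hx.1, ?_⟩
    linarith [hx.2]
  · rw [secondOrderApprox, t₀, approxTerm, approxTerm, t₁, t₂]
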